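/- Let $\mathbb{H}=\prod_{n\ge 1}[0,\tfrac1n]$ be the Hilbert cube with the product topology (equivalently, the topology of the metric $\max_n|x(n)-y(n)|$). For $B\subseteq\mathbb{H}$ and $S\subseteq B$, write $\mathrm{Int}_B S$ for the interior of $S$ in the subspace $B$. Let $Y$ be a metrizable space. (1) For every separable subset $A\subseteq Y$ there is a continuous function $\varphi:Y\to\mathbb{H}$ that satisfies, for all open $U\subseteq Y$, both $$(*)\quad \varphi[U\cap A]\subseteq \mathrm{Int}_{\varphi[Y]}\,\varphi[U]$$ and the stronger $$(**)\quad \varphi[U\cap A]\subseteq \mathrm{Int}_{\varphi[Y]}\bigl(\varphi[U]\setminus\varphi[Y\setminus U]\bigr).$$ (2) Let $X$ be any set or topological space, let $f:X\to Y$ be a function whose image $A=f[X]$ is separable, and let $\varphi:Y\to\mathbb{H}$ be any continuous function satisfying $(**)$ for all open $U\subseteq Y$ (such a $\varphi$ exists by (1)). Then for every family $P$ of functions $X\to Y$, $$f\in\overline{P}\iff \varphi\circ f\in\overline{\{\varphi\circ h: h\in P\}},$$ where the closures are taken in the topologies of pointwise convergence on $Y^X$ and $\mathbb{H}^X$. 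-/

import Mathlib

/-- The Hilbert cube `∏ₙ [0, 1/n]` over the positive integers `n` (indexed here by `n + 1` for
`n : ℕ`), with its product topology; this is the topology of the metric
`d(x, y) = maxₙ |x(n) - y(n)|`. -/
abbrev HilbertCube : Type := ∀ n : ℕ, Set.Icc (0 : ℝ) (1 / ((n : ℝ) + 1))

/-- `relInterior B S` is the interior of `S ∩ B` in the subspace `B`, as a subset of the ambient
space. -/
def relInterior {Z : Type*} [TopologicalSpace Z] (B S : Set Z) : Set Z :=
  ((↑) : B → Z) '' interior (((↑) : B → Z) ⁻¹' S)

/-- `φ` is open at the points of `A`, relative to its image: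
`φ[U ∩ A] ⊆ Int_{φ[Y]} φ[U]` for all open `U`. -/
def IsOpenAtPoints {Y Z : Type*} [TopologicalSpace Y] [TopologicalSpace Z]
    (φ : Y → Z) (A : Set Y) : Prop :=
  ∀ U : Set Y, IsOpen U → φ '' (U ∩ A) ⊆ relInterior (Set.range φ) (φ '' U)

/-- `φ` is strongly open at the points of `A`, relative to its image:
`φ[U ∩ A] ⊆ Int_{φ[Y]} (φ[U] \ φ[Y \ U])` for all open `U`. -/
def IsStronglyOpenAtPoints {Y Z : Type*} [TopologicalSpace Y] [TopologicalSpace Z]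
    (φ : Y → Z) (A : Set Y) : Prop :=
  ∀ U : Set Y, IsOpen U → φ '' (U ∩ A) ⊆ relInterior (Set.range φ) (φ '' U \ φ '' Uᶜ)

/-! Strong openness at `A` amounts to `comap φ (𝓝 (φ y)) ≤ 𝓝 y` for all `y ∈ A`; for continuous `φ`
this is equality. Truncated distances to a dense sequence of `A` provide such a `φ`
(`comap_nhds_distToHilbertCube_le`). Closures then transfer because `𝓝 f` is determined by the
filters `𝓝 (f x)`. -/

open Filter Topology in
/-- Strong openness at `A` gives every point of `A` enough neighbourhoods pulled back from the
codomain. -/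
theorem IsStronglyOpenAtPoints.comap_nhds_le {Y Z : Type*} [TopologicalSpace Y]
    [TopologicalSpace Z] {φ : Y → Z} {A : Set Y} (h : IsStronglyOpenAtPoints φ A) {y : Y}
    (hy : y ∈ A) : comap φ (𝓝 (φ y)) ≤ 𝓝 y := by
  intro s hs
  obtain ⟨U, hUs, hU, hyU⟩ := mem_nhds_iff.1 hs
  obtain ⟨z, hz, hzy⟩ := h U hU ⟨y, ⟨hyU, hy⟩, rfl⟩
  rw [mem_interior_iff_mem_nhds, nhds_subtype_eq_comap, hzy] at hz
  obtain ⟨V, hV, hVU⟩ := hz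
  refine ⟨V, hV, fun w hw => hUs ?_⟩
  have hw' := hVU (show (⟨φ w, w, rfl⟩ : Set.range φ) ∈ _ from hw)
  by_contra hwU
  exact hw'.2 ⟨w, hwU, rfl⟩

open Filter Topology in
theorem IsStronglyOpenAtPoints.of_comap_nhds_le {Y Z : Type*} [TopologicalSpace Y]
    [TopologicalSpace Z] {φ : Y → Z} {A : Set Y}
    (h : ∀ y ∈ A, comap φ (𝓝 (φ y)) ≤ 𝓝 y) : IsStronglyOpenAtPoints φ A := by
  rintro U hU _ ⟨y, ⟨hyU, hyA⟩, rfl⟩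
  obtain ⟨V, hV, hVU⟩ := h y hyA (hU.mem_nhds hyU)
  refine ⟨⟨φ y, Set.mem_range_self y⟩, ?_, rfl⟩
  rw [mem_interior_iff_mem_nhds, nhds_subtype_eq_comap]
  refine ⟨V, hV, ?_⟩
  rintro ⟨_, w, rfl⟩ hw
  refine ⟨⟨w, hVU hw, rfl⟩, ?_⟩
  rintro ⟨w', hw', hww'⟩
  exact hw' (hVU (show φ w' ∈ V from hww' ▸ hw))

theorem IsStronglyOpenAtPoints.isOpenAtPoints {Y Z : Type*} [TopologicalSpace Y]
    [TopologicalSpace Z] {φ : Y → Z} {A : Set Y} (h : IsStronglyOpenAtPoints φ A) :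
    IsOpenAtPoints φ A := fun U hU =>
  (h U hU).trans (Set.image_mono (interior_mono (Set.preimage_mono Set.sdiff_subset)))

/-- The truncated distances to the points of a sequence, scaled into the Hilbert cube. -/
noncomputable def distToHilbertCube {Y : Type*} [PseudoMetricSpace Y] (a : ℕ → Y) (y : Y) :
    HilbertCube := fun n =>
  ⟨min (dist y (a n)) 1 / ((n : ℝ) + 1), by positivity, by gcongr; exact min_le_right _ _⟩

theorem continuous_distToHilbertCube {Y : Type*} [PseudoMetricSpace Y] (a : ℕ → Y) :
    Continuous (distToHilbertCube a) :=
  continuous_pi fun n => Continuous.subtype_mk (by fun_prop) _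

-- A single coordinate suffices: if `a n` is close to `y`, every `w` close to `a n` is close to `y`.
open Filter Topology in
theorem comap_nhds_distToHilbertCube_le {Y : Type*} [PseudoMetricSpace Y] {a : ℕ → Y} {y : Y}
    (hy : y ∈ closure (Set.range a)) :
    comap (distToHilbertCube a) (𝓝 (distToHilbertCube a y)) ≤ 𝓝 y := by
  intro s hs
  obtain ⟨ε, hε, hεs⟩ := Metric.mem_nhds_iff.1 hs
  -- `ε / 2` is for the triangle inequality through `a n`; the cap `1` makes the truncation
  -- harmless.
  have hδ : 0 < min (ε / 2) 1 := by positivity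
  obtain ⟨n, hn⟩ := Metric.mem_closure_range_iff.1 hy _ hδ
  have key : ∀ w : Y, ((distToHilbertCube a w n : ℝ) < min (ε / 2) 1 / ((n : ℝ) + 1)) ↔
      dist w (a n) < min (ε / 2) 1 := by
    intro w
    change min (dist w (a n)) 1 / ((n : ℝ) + 1) < _ ↔ _
    rw [div_lt_div_iff_of_pos_right (by positivity), min_lt_iff]
    exact or_iff_left (not_lt.2 (min_le_right _ _))
  refine ⟨{z | (z n : ℝ) < min (ε / 2) 1 / ((n : ℝ) + 1)}, ?_, fun w hw => hεs ?_⟩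
  · exact (isOpen_lt (by fun_prop) continuous_const).mem_nhds ((key y).2 hn)
  · have hw' := (key w).1 hw
    have h₁ := min_le_left (ε / 2) 1
    have h₂ := dist_triangle_right w y (a n)
    exact Metric.mem_ball.2 (by linarith)

theorem exists_isStronglyOpenAtPoints_hilbertCube {Y : Type*} [TopologicalSpace Y]
    [TopologicalSpace.PseudoMetrizableSpace Y] (A : Set Y) [TopologicalSpace.SeparableSpace A] :
    ∃ φ : Y → HilbertCube, Continuous φ ∧ IsStronglyOpenAtPoints φ A := by
  let _ := TopologicalSpace.pseudoMetrizableSpacePseudoMetric Y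
  rcases A.eq_empty_or_nonempty with rfl | hA
  -- `denseSeq` needs a nonempty type; for empty `A` any constant map works.
  · exact ⟨fun _ _ => ⟨0, le_rfl, by positivity⟩, continuous_const,
      .of_comap_nhds_le fun y hy => hy.elim⟩
  · have := hA.to_subtype
    refine ⟨distToHilbertCube fun n => (TopologicalSpace.denseSeq A n : Y),
      continuous_distToHilbertCube _,
      .of_comap_nhds_le fun y hy => comap_nhds_distToHilbertCube_le ?_⟩
    have hmem : (⟨y, hy⟩ : A) ∈ closure (Set.range (TopologicalSpace.denseSeq A)) :=
      TopologicalSpace.denseRange_denseSeq A _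
    rw [closure_subtype, ← Set.range_comp] at hmem
    exact hmem

open Filter Topology in
/-- Pointwise approximation of `f` can be tested after composing with a continuous map that is
strongly open at the points of the range of `f`. -/
theorem IsStronglyOpenAtPoints.mem_closure_iff_comp {X Y Z : Type*} [TopologicalSpace Y]
    [TopologicalSpace Z] {φ : Y → Z} (hφ : Continuous φ) {f : X → Y}
    (h : IsStronglyOpenAtPoints φ (Set.range f)) (P : Set (X → Y)) :
    f ∈ closure P ↔ φ ∘ f ∈ closure ((fun h : X → Y => φ ∘ h) '' P) := by
  -- Both sides are infima over `x`, compared coordinatewise at `f x`.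
  have hnhds : 𝓝 f = comap (fun h : X → Y => φ ∘ h) (𝓝 (φ ∘ f)) := by
    simp only [nhds_pi, Filter.pi, comap_iInf, comap_comap]
    refine iInf_congr fun x => ?_
    rw [le_antisymm hφ.continuousAt.tendsto.le_comap (h.comap_nhds_le ⟨x, rfl⟩), comap_comap]
    rfl
  rw [mem_closure_iff_frequently, mem_closure_iff_frequently, hnhds, frequently_comap]
  simp only [Set.mem_image, and_comm]

theorem mainTheorem6 {Y : Type*} [TopologicalSpace Y] [TopologicalSpace.MetrizableSpace Y]
    {X : Type*} :
    (∀ A : Set Y, TopologicalSpace.SeparableSpace A →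
      ∃ φ : Y → HilbertCube, Continuous φ ∧ IsOpenAtPoints φ A ∧ IsStronglyOpenAtPoints φ A) ∧
    (∀ f : X → Y, TopologicalSpace.SeparableSpace (Set.range f) →
      ∀ φ : Y → HilbertCube, Continuous φ → IsStronglyOpenAtPoints φ (Set.range f) →
        ∀ P : Set (X → Y),
          f ∈ closure P ↔ φ ∘ f ∈ closure ((fun h : X → Y => φ ∘ h) '' P)) :=
  ⟨fun A _ =>
    let ⟨φ, hφ, h⟩ := exists_isStronglyOpenAtPoints_hilbertCube A
    ⟨φ, hφ, h.isOpenAtPoints, h⟩,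
  fun _ _ _ hφ h P => h.mem_closure_iff_comp hφ P⟩
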